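/- Let $J$ be an index set, let $C_j\in\mathbb{R}^{n\times n}$ ($j\in J$) be invertible matrices, and let $\Gamma_j=C_j\mathbb{Z}^n$ be the corresponding lattices in $\mathbb{R}^n$. Assume that there is a constant $K$ such that for every $j\in J$ the quotient of the maximal and the minimal singular value of $C_j$ is at most $K$. If the bandwidth $$BW=\sum_{j\in J}\frac{1}{\operatorname{covol}(\Gamma_j)}$$ is infinite, where $\operatorname{covol}(\Gamma_j)$ denotes the Lebesgue measure of a fundamental domain of $\Gamma_j$, then there exists a family of tight frame generators for $(\Gamma_j)_{j\in J}$, that is, a family $(g_j)_{j\in J}$ in $L^2(\mathbb{R}^n)$ (some of the $g_j$ may be zero) such that the system of translates $(T_\gamma g_j)_{j\in J,\,\gamma\in\Gamma_j}$, with $T_\gamma f=f(\cdot-\gamma)$, is a tight frame for $L^2(\mathbb{R}^n)$ with frame bounds $A=B=1$: $$\sum_{j\in J}\sum_{\gamma\in\Gamma_j}|\langle f,T_\gamma g_j\rangle|^2=\|f\|^2\qquad\text{for all } f\in L^2(\mathbb{R}^n).$$ -/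

import Mathlib

open MeasureTheory

noncomputable section

/-- A family `η` in a Hilbert space is a frame with frame bounds `A` and `B`:
`0 < A` and `A ‖f‖² ≤ ∑ i, |⟨f, η i⟩|² ≤ B ‖f‖²` for all `f`, the series being convergent. -/
def IsFrameWithBounds {H : Type*} [NormedAddCommGroup H] [InnerProductSpace ℂ H] {ι : Type*}
    (A B : ℝ) (η : ι → H) : Prop :=
  0 < A ∧ ∀ f : H,
    Summable (fun i => ‖inner ℂ f (η i)‖ ^ 2) ∧
    A * ‖f‖ ^ 2 ≤ ∑' i, ‖inner ℂ f (η i)‖ ^ 2 ∧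
    ∑' i, ‖inner ℂ f (η i)‖ ^ 2 ≤ B * ‖f‖ ^ 2

/-- A tight frame, normalised to the frame bounds `A = B = 1` (a Parseval frame). -/
def IsTightFrame {H : Type*} [NormedAddCommGroup H] [InnerProductSpace ℂ H] {ι : Type*}
    (η : ι → H) : Prop :=
  IsFrameWithBounds 1 1 η

/-- The Hilbert space `L²(ℝⁿ)` of complex-valued square integrable functions. -/
abbrev L2 (n : ℕ) : Type := Lp ℂ 2 (volume : Measure (EuclideanSpace ℝ (Fin n)))

/-- The translation operator `T_γ f = f(· - γ)` on `L²(ℝⁿ)`. -/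
def translation {n : ℕ} (γ : EuclideanSpace ℝ (Fin n)) (f : L2 n) : L2 n :=
  Lp.compMeasurePreserving (fun x => x - γ) (measurePreserving_sub_right volume γ) f

/-- The subgroup `C ℤⁿ` of `ℝⁿ` (a lattice when `C` is invertible). -/
def matrixLattice {n : ℕ} (C : Matrix (Fin n) (Fin n) ℝ) :
    Submodule ℤ (EuclideanSpace ℝ (Fin n)) where
  carrier := {x | ∃ k : Fin n → ℤ, x = WithLp.toLp 2 (C.mulVec fun i => (k i : ℝ))}
  zero_mem' := ⟨0, by
    ext i
    simp [Matrix.mulVec, dotProduct]⟩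
  add_mem' := by
    rintro _ _ ⟨k, rfl⟩ ⟨l, rfl⟩
    refine ⟨k + l, ?_⟩
    ext i
    simp [Matrix.mulVec, dotProduct, mul_add, Finset.sum_add_distrib]
  smul_mem' := by
    rintro c _ ⟨k, rfl⟩
    refine ⟨c • k, ?_⟩
    ext i
    simp [Matrix.mulVec, dotProduct, Finset.mul_sum, mul_left_comm]

/-- The bandwidth `∑ j, 1 / covol(Γ j) ∈ [0, ∞]` of a family of lattices in `ℝⁿ`, the covolume
being the Lebesgue measure of a fundamental domain. -/
def bandwidth {n : ℕ} {J : Type*} (Γ : J → Submodule ℤ (EuclideanSpace ℝ (Fin n))) : ENNReal :=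
  ∑' j, ENNReal.ofReal (1 / ZLattice.covolume (Γ j) volume)

/-- The generalized shift-invariant system `(T_γ g_j)`, indexed by `j` and `γ ∈ Γ j`. -/
def gsiSystem {n : ℕ} {J : Type*} (Γ : J → Submodule ℤ (EuclideanSpace ℝ (Fin n)))
    (g : J → L2 n) : (Σ j, Γ j) → L2 n :=
  fun p => translation (p.2 : EuclideanSpace ℝ (Fin n)) (g p.1)

/-- The family `g` is a family of tight frame generators for the family of lattices `Γ`. -/
def IsTightFrameGenerators {n : ℕ} {J : Type*}
    (Γ : J → Submodule ℤ (EuclideanSpace ℝ (Fin n))) (g : J → L2 n) : Prop :=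
  IsTightFrame (gsiSystem Γ g)

/-- The largest singular value of an `n × n` real matrix (Mathlib lists the singular values of a
linear map in decreasing order, at the indices `0, …, n - 1`). -/
def maxSingularValue {n : ℕ} (C : Matrix (Fin n) (Fin n) ℝ) : ℝ :=
  (Matrix.toEuclideanLin C).singularValues 0

/-- The smallest singular value of an `n × n` real matrix. -/
def minSingularValue {n : ℕ} (C : Matrix (Fin n) (Fin n) ℝ) : ℝ :=
  (Matrix.toEuclideanLin C).singularValues (n - 1)

end

/-!
The generators are band-limited: `ĝ_j = |det C_j|^{1/2} 1_{E_j}` for measurable sets `E_j` that tile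
the frequency space `ℝⁿ` up to a null set.

If `C_jᵀ E_j` is contained in a unit cube, then the substitution `η = C_jᵀ ξ` turns the numbers
`⟨f, T_γ g_j⟩`, `γ ∈ C_j ℤⁿ`, into the Fourier coefficients on that cube of a multiple of
`conj (f̂ 1_{E_j})`, and Parseval's identity gives `∑_γ |⟨f, T_γ g_j⟩|² = ∫_{E_j} |f̂|²`
(`hasSum_sq_norm_inner_translation_bandGenerator`). Summing over `j` and applying Plancherel's
theorem yields `‖f‖²` (`isTightFrameGenerators_bandGenerator`).

It remains to find the tiling. A ball of radius `r_j = min 1 (1 / (4 σ_max(C_j)))` is mapped by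
`C_jᵀ` into a unit cube. As `σ_max ≤ K σ_min` and `σ_minⁿ ≤ |det C_j| = covol(Γ_j)`, its volume is at
least a constant times `min 1 (1 / covol(Γ_j))` (`exists_radius`). Hence infinite bandwidth makes the
volumes of these balls sum to infinity, already along a sequence of indices. For such a sequence,
let `ν` be a finite measure equivalent to Lebesgue measure, and put the balls down one after the
other, each time at a centre for which the `ν`-measure of the newly covered part is at least half
the supremum. If a set `V` of positive measure, which may be taken bounded, were never covered, then
averaging over all centres shows that each new part has `ν`-measure at least a constant times the
volume of its ball, so that the disjoint new parts would have infinite total measure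
(`exists_disjoint_subset_ball_ae_cover`).
-/

open scoped ENNReal FourierTransform RealInnerProductSpace ComplexConjugate

/-! ### Covering by translates of balls -/

section Covering

variable {E : Type*} [NormedAddCommGroup E] [NormedSpace ℝ E] [FiniteDimensional ℝ E]
  [MeasurableSpace E] [BorelSpace E]

/-- By Tonelli, the integral over all centres `x` of `ν (V ∩ ball x r)` is `ν V` times the volume of
the ball, while the integrand vanishes unless the ball meets `V`. -/
theorem measure_mul_measure_ball_le_iSup (μ : Measure E) [μ.IsAddHaarMeasure] (ν : Measure E)
    [SFinite ν] {V : Set E} (hV : MeasurableSet V) {R r : ℝ} (hVR : V ⊆ Metric.ball 0 R)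
    (hr : r ≤ 1) :
    ν V * μ (Metric.ball 0 r) ≤
      (⨆ x, ν (V ∩ Metric.ball x r)) * μ (Metric.ball 0 (R + 1)) := by
  have hmeas : Measurable (Function.uncurry fun x y : E =>
      V.indicator (fun _ => (1 : ℝ≥0∞)) y * (Metric.ball (0 : E) r).indicator 1 (y - x)) := by
    refine ((measurable_const.indicator hV).comp measurable_snd).mul
      ((measurable_one.indicator measurableSet_ball).comp (measurable_snd.sub measurable_fst))
  have h1 : ∀ x, ∫⁻ y, V.indicator (fun _ => (1 : ℝ≥0∞)) y *
      (Metric.ball (0 : E) r).indicator 1 (y - x) ∂ν = ν (V ∩ Metric.ball x r) := by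
    intro x
    rw [← lintegral_indicator_one (hV.inter measurableSet_ball)]
    refine lintegral_congr fun y => ?_
    by_cases hy : y ∈ V <;> by_cases hy' : y ∈ Metric.ball x r <;>
      simp_all [Set.indicator, dist_eq_norm]
  have h2 : ∀ y, ∫⁻ x, V.indicator (fun _ => (1 : ℝ≥0∞)) y *
      (Metric.ball (0 : E) r).indicator 1 (y - x) ∂μ =
        V.indicator (fun _ => μ (Metric.ball 0 r)) y := by
    intro y
    have : ∀ x, (Metric.ball (0 : E) r).indicator (1 : E → ℝ≥0∞) (y - x) =
        (Metric.ball y r).indicator 1 x := by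
      intro x
      by_cases hx : x ∈ Metric.ball y r <;>
        simp_all [Set.indicator, dist_eq_norm, norm_sub_rev]
    simp_rw [this]
    rw [lintegral_const_mul _ (measurable_one.indicator measurableSet_ball),
      lintegral_indicator_one measurableSet_ball, Measure.addHaar_ball_center]
    by_cases hy : y ∈ V <;> simp [hy]
  calc ν V * μ (Metric.ball 0 r)
      = ∫⁻ y, V.indicator (fun _ => μ (Metric.ball 0 r)) y ∂ν := by
        rw [lintegral_indicator_const hV, mul_comm]
    _ = ∫⁻ x, ν (V ∩ Metric.ball x r) ∂μ := by
        simp_rw [← h1, ← h2]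
        exact (lintegral_lintegral_swap hmeas.aemeasurable).symm
    _ ≤ ∫⁻ x, (Metric.ball (0 : E) (R + 1)).indicator
          (fun _ => ⨆ x, ν (V ∩ Metric.ball x r)) x ∂μ := by
        refine lintegral_mono fun x => ?_
        by_cases hx : x ∈ Metric.ball (0 : E) (R + 1)
        · rw [Set.indicator_of_mem hx]
          exact le_iSup (fun x => ν (V ∩ Metric.ball x r)) x
        · have : V ∩ Metric.ball x r = ∅ := by
            rw [Set.eq_empty_iff_forall_notMem]
            rintro y ⟨hy, hyx⟩
            have h3 := hVR hy
            rw [Metric.mem_ball] at h3 hyx hx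
            have := dist_triangle x y 0
            rw [dist_comm] at hyx
            linarith
          simp [this]
    _ = _ := lintegral_indicator_const measurableSet_ball _

theorem exists_iSup_measure_inter_ball_le {E : Type*} [SeminormedAddCommGroup E]
    [MeasurableSpace E] (ν : Measure E) [IsFiniteMeasure ν] (U : Set E) (r : ℝ) :
    ∃ x, ⨆ y, ν (U ∩ Metric.ball y r) ≤ 2 * ν (U ∩ Metric.ball x r) := by
  set S := ⨆ y, ν (U ∩ Metric.ball y r) with hS
  rcases eq_or_ne S 0 with h0 | h0
  · exact ⟨0, by simp [h0]⟩
  · have hfin : S ≠ ⊤ := by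
      refine ne_top_of_le_ne_top (measure_ne_top ν Set.univ) ?_
      exact iSup_le fun y => measure_mono (Set.subset_univ _)
    obtain ⟨x, hx⟩ := lt_iSup_iff.1 (ENNReal.half_lt_self h0 hfin)
    refine ⟨x, ?_⟩
    calc S = 2 * (S / 2) := by rw [ENNReal.mul_div_cancel (by simp) (by simp)]
      _ ≤ _ := by gcongr

/-- Balls of bounded radius with infinite total volume can be moved so that they cover the space up
to a null set; the sets `s k` are the parts of the balls that are not covered before. -/
theorem exists_disjoint_subset_ball_ae_cover (μ : Measure E) [μ.IsAddHaarMeasure] (r : ℕ → ℝ)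
    (hr : ∀ k, r k ≤ 1) (hsum : ∑' k, μ (Metric.ball (0 : E) (r k)) = ⊤) :
    ∃ (s : ℕ → Set E) (x : ℕ → E), (∀ k, MeasurableSet (s k)) ∧
      Pairwise (Function.onFun Disjoint s) ∧
      (∀ k, s k ⊆ Metric.ball (x k) (r k)) ∧ μ (⋃ k, s k)ᶜ = 0 := by
  set ν := μ.toFinite
  choose c hc using exists_iSup_measure_inter_ball_le ν
  -- `U k` is the region not covered by the first `k` balls
  let U : ℕ → Set E := fun k =>
    Nat.rec Set.univ (fun k V => V \ Metric.ball (c V (r k)) (r k)) k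
  have hU : ∀ k, U (k + 1) = U k \ Metric.ball (c (U k) (r k)) (r k) := fun k => rfl
  have hUm : ∀ k, MeasurableSet (U k) := by
    intro k
    induction k with
    | zero => exact MeasurableSet.univ
    | succ k ih => exact ih.diff measurableSet_ball
  have hanti : Antitone U := antitone_nat_of_succ_le fun k => Set.sdiff_subset
  let s : ℕ → Set E := fun k => U k ∩ Metric.ball (c (U k) (r k)) (r k)
  have hsm : ∀ k, MeasurableSet (s k) := fun k => (hUm k).inter measurableSet_ball
  have hdisj : Pairwise (Function.onFun Disjoint s) := by
    have hlt : ∀ m k, m < k → Disjoint (s m) (s k) := fun m k hmk =>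
      Set.disjoint_left.2 fun y hy hy' => (hanti (Nat.succ_le_of_lt hmk) hy'.1).2 hy.2
    intro m k hmk
    rcases hmk.lt_or_gt with h | h
    exacts [hlt m k h, (hlt k m h).symm]
  refine ⟨s, fun k => c (U k) (r k), hsm, hdisj, fun k => Set.inter_subset_right, ?_⟩
  have hrest : ∀ k, (⋃ k, s k)ᶜ ⊆ U k := by
    intro k
    induction k with
    | zero => exact Set.subset_univ _
    | succ k ih =>
      intro y hy
      exact ⟨ih hy, fun h => hy (Set.mem_iUnion.2 ⟨k, ih hy, h⟩)⟩
  -- otherwise a bounded part `V` of the uncovered region has positive measure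
  by_contra hpos
  have hpos' : ν (⋃ k, s k)ᶜ ≠ 0 := fun h => hpos (absolutelyContinuous_toFinite μ h)
  obtain ⟨R, hR⟩ : ∃ R : ℕ, ν ((⋃ k, s k)ᶜ ∩ Metric.ball 0 R) ≠ 0 := by
    by_contra! h
    apply hpos'
    rw [← Set.inter_univ (⋃ k, s k)ᶜ, ← Metric.iUnion_ball_nat (0 : E), Set.inter_iUnion]
    exact measure_iUnion_null h
  set V := (⋃ k, s k)ᶜ ∩ Metric.ball 0 (R : ℝ) with hVdef
  have hVm : MeasurableSet V := (MeasurableSet.iUnion hsm).compl.inter measurableSet_ball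
  have hbound : ∀ k, ν V * μ (Metric.ball 0 (r k)) ≤
      2 * μ (Metric.ball 0 ((R : ℝ) + 1)) * ν (s k) := by
    intro k
    refine (measure_mul_measure_ball_le_iSup μ ν hVm Set.inter_subset_right (hr k)).trans ?_
    have : ⨆ x, ν (V ∩ Metric.ball x (r k)) ≤ 2 * ν (s k) := by
      refine le_trans (iSup_mono fun x => ?_) (hc (U k) (r k))
      exact measure_mono (Set.inter_subset_inter_left _ (Set.inter_subset_left.trans (hrest k)))
    calc _ ≤ (2 * ν (s k)) * μ (Metric.ball 0 ((R : ℝ) + 1)) := by gcongr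
      _ = _ := by ring
  have htop : (⊤ : ℝ≥0∞) ≤ 2 * μ (Metric.ball 0 ((R : ℝ) + 1)) * ν Set.univ := by
    calc (⊤ : ℝ≥0∞) = ν V * ∑' k, μ (Metric.ball (0 : E) (r k)) := by
          rw [hsum, ENNReal.mul_top hR]
      _ = ∑' k, ν V * μ (Metric.ball (0 : E) (r k)) := ENNReal.tsum_mul_left.symm
      _ ≤ ∑' k, 2 * μ (Metric.ball 0 ((R : ℝ) + 1)) * ν (s k) := ENNReal.tsum_le_tsum hbound
      _ = 2 * μ (Metric.ball 0 ((R : ℝ) + 1)) * ν (⋃ k, s k) := by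
          rw [ENNReal.tsum_mul_left, measure_iUnion hdisj hsm]
      _ ≤ _ := by gcongr; exact Set.subset_univ _
  refine absurd (top_le_iff.1 htop) ?_
  exact ENNReal.mul_ne_top (ENNReal.mul_ne_top (by simp) measure_ball_lt_top.ne)
    (measure_ne_top _ _)

end Covering

/-! ### Divergent sums -/

theorem ENNReal.tsum_min_one_eq_top {ι : Type*} {b : ι → ℝ≥0∞} (hb : ∀ i, b i ≠ ⊤)
    (h : ∑' i, b i = ⊤) : ∑' i, min 1 (b i) = ⊤ := by
  classical
  by_contra hne
  -- only finitely many terms are affected by the truncation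
  have hfin : {i | 1 ≤ min 1 (b i)}.Finite :=
    ENNReal.finite_const_le_of_tsum_ne_top hne one_ne_zero
  have hle : ∑' i, b i ≤ ∑ i ∈ hfin.toFinset, b i + ∑' i, min 1 (b i) := by
    have : ∑ i ∈ hfin.toFinset, b i = ∑' i, if i ∈ hfin.toFinset then b i else 0 := by
      rw [tsum_eq_sum (s := hfin.toFinset) (fun i hi => if_neg hi)]
      exact Finset.sum_congr rfl fun i hi => by simp only [hi, if_true]
    rw [this, ← ENNReal.tsum_add]
    refine ENNReal.tsum_le_tsum fun i => ?_
    by_cases hi : i ∈ hfin.toFinset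
    · simp only [hi, if_true]; exact le_self_add
    · have : b i < 1 := by
        by_contra! hi'
        exact hi (by simpa using hi')
      rw [min_eq_right this.le]
      exact le_add_self
  rw [h, top_le_iff] at hle
  exact absurd hle (ENNReal.add_ne_top.2 ⟨ENNReal.sum_ne_top.2 fun i _ => hb i, hne⟩)

theorem ENNReal.exists_injective_tsum_eq_top {ι : Type*} {b : ι → ℝ≥0∞} (hb : ∀ i, b i ≠ ⊤)
    (h : ∑' i, b i = ⊤) : ∃ e : ℕ → ι, Function.Injective e ∧ ∑' k, b (e k) = ⊤ := by
  have hex : ∀ N : ℕ, ∃ F : Finset ι, (N : ℝ≥0∞) < ∑ i ∈ F, b i := by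
    intro N
    rw [← lt_iSup_iff, ← ENNReal.tsum_eq_iSup_sum, h]
    exact ENNReal.natCast_lt_top N
  choose F hF using hex
  set s : Set ι := ⋃ N, (F N : Set ι)
  have hs : s.Countable := Set.countable_iUnion fun N => (F N).countable_toSet
  have hsum : ∑' i : s, b i = ⊤ := by
    refine ENNReal.eq_top_of_forall_nnreal_le fun x => ?_
    obtain ⟨N, hN⟩ := exists_nat_ge x
    calc (x : ℝ≥0∞) ≤ N := by exact_mod_cast hN
      _ ≤ ∑ i ∈ F N, b i := (hF N).le
      _ = ∑' i : (F N : Set ι), b i := (Finset.tsum_subtype' (F N) b).symm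
      _ ≤ _ := ENNReal.tsum_mono_subtype b (Set.subset_iUnion (fun N => (F N : Set ι)) N)
  have hinf : s.Infinite := by
    intro hfin
    have : Fintype s := hfin.fintype
    rw [tsum_fintype] at hsum
    exact ENNReal.sum_ne_top.2 (fun (i : s) _ => hb i) hsum
  have := hinf.to_subtype
  have := hs.to_subtype
  obtain ⟨e⟩ := nonempty_equiv_of_countable (α := ℕ) (β := s)
  exact ⟨fun k => e k, Subtype.val_injective.comp e.injective,
    by rw [← hsum]; exact e.tsum_eq (fun i : s => b i)⟩

/-! ### Parseval's identity on a cube -/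

section Cube

variable {d : Type*} [Fintype d]

-- the normalisation under which Mathlib states Parseval's identity on the torus
noncomputable local instance : MeasureSpace UnitAddCircle := ⟨AddCircle.haarAddCircle⟩

local instance : IsProbabilityMeasure (volume : Measure UnitAddCircle) :=
  inferInstanceAs (IsProbabilityMeasure AddCircle.haarAddCircle)

theorem UnitAddTorus.mFourier_apply_coe (k : d → ℤ) (x : d → ℝ) :
    UnitAddTorus.mFourier k (fun i => (x i : UnitAddCircle)) =
      Complex.exp (2 * Real.pi * Complex.I * ∑ i, (k i : ℂ) * x i) := by
  simp only [UnitAddTorus.mFourier, ContinuousMap.coe_mk, fourier_coe_apply, Finset.mul_sum,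
    Complex.exp_sum]
  refine Finset.prod_congr rfl fun i _ => ?_
  congr 1
  push_cast
  ring

/-- Parseval's identity for a function on `ℝᵈ` supported in the unit cube with corner `a`. -/
theorem hasSum_sq_norm_integral_exp_mul (a : d → ℝ) {H : (d → ℝ) → ℂ} (hH : MemLp H 2 volume)
    (hsupp : ∀ x, H x ≠ 0 → ∀ i, x i ∈ Set.Ioc (a i) (a i + 1)) :
    HasSum (fun k : d → ℤ =>
      ‖∫ x, Complex.exp (-(2 * Real.pi * Complex.I * ∑ i, (k i : ℂ) * x i)) * H x‖ ^ 2)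
      (∫ x, ‖H x‖ ^ 2) := by
  set Q : Set (d → ℝ) := {x | ∀ i, x i ∈ Set.Ioc (a i) (a i + 1)} with hQ
  have hQm : MeasurableSet Q := MeasurableSet.univ_pi' fun i => measurableSet_Ioc
  set F : UnitAddTorus d → ℂ := fun t => H (UnitAddTorus.measurableEquivPiIoc a t).1 with hFdef
  have hF : MemLp F 2 volume := by
    have h1 : MemLp (fun y : Q => H y) 2 (Measure.comap Subtype.val volume) :=
      (memLp_map_measure_iff ((map_comap_subtype_coe hQm volume).symm ▸
        hH.1.mono_measure Measure.restrict_le_self) measurable_subtype_coe.aemeasurable).1 (by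
        rw [map_comap_subtype_coe hQm]
        exact hH.restrict Q)
    exact h1.comp_measurePreserving (UnitAddTorus.measurePreserving_equivPiIoc a)
  have hFcoe : ∀ x ∈ Q, F (fun i => (x i : UnitAddCircle)) = H x := by
    intro x hx
    have := (UnitAddTorus.measurableEquivPiIoc a).apply_symm_apply ⟨x, hx⟩
    rw [UnitAddTorus.coe_symm_measurableEquivPiIoc_apply] at this
    simp only [hFdef]
    rw [this]
  have hsupp' : ∀ x, x ∉ Q → H x = 0 := fun x hx => by
    by_contra h
    exact hx (hsupp x h)
  have hpars := UnitAddTorus.hasSum_sq_mFourierCoeff (hF.toLp F)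
  convert hpars using 1
  · funext k
    congr 2
    have : UnitAddTorus.mFourierCoeff (hF.toLp F) k = UnitAddTorus.mFourierCoeff F k := by
      refine integral_congr_ae ?_
      filter_upwards [hF.coeFn_toLp] with t ht
      rw [ht]
    rw [this, UnitAddTorus.mFourierCoeff_eq_integral F k a]
    rw [← setIntegral_eq_integral_of_forall_compl_eq_zero (s := Q)
      (fun x hx => by rw [hsupp' x hx, mul_zero])]
    refine setIntegral_congr_fun hQm fun x hx => ?_
    rw [hFcoe x hx, UnitAddTorus.mFourier_apply_coe, smul_eq_mul]
    congr 2
    simp [Finset.sum_neg_distrib]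
  · have h2 : ∫ t, ‖hF.toLp F t‖ ^ 2 = ∫ t, ‖F t‖ ^ 2 := by
      refine integral_congr_ae ?_
      filter_upwards [hF.coeFn_toLp] with t ht
      rw [ht]
    rw [h2, UnitAddTorus.integral_preimage _ a]
    rw [← setIntegral_eq_integral_of_forall_compl_eq_zero (s := Q)
      (fun x hx => by rw [hsupp' x hx]; simp)]
    refine setIntegral_congr_fun hQm fun x hx => ?_
    rw [hFcoe x hx]

end Cube

/-! ### Parseval's identity for a lattice -/

section Lattice

variable {n : ℕ}

theorem map_transpose_mulVec_volume {C : Matrix (Fin n) (Fin n) ℝ} (hC : IsUnit C) :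
    Measure.map (fun ξ : EuclideanSpace ℝ (Fin n) => C.transpose.mulVec ξ.ofLp) volume =
      ENNReal.ofReal |C.det|⁻¹ • (volume : Measure (Fin n → ℝ)) := by
  have hdet : C.transpose.det ≠ 0 := by
    rw [Matrix.det_transpose]
    exact ((Matrix.isUnit_iff_isUnit_det C).1 hC).ne_zero
  have h1 := Real.map_matrix_volume_pi_eq_smul_volume_pi hdet
  rw [Matrix.det_transpose, abs_inv] at h1
  rw [← h1, ← (PiLp.volume_preserving_ofLp (Fin n)).map_eq,
    Measure.map_map (LinearMap.continuous_on_pi _).measurable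
      (PiLp.volume_preserving_ofLp (Fin n)).measurable]
  rfl

/-- Parseval's identity for the exponentials with frequencies in `C ℤⁿ` and a function supported in
the preimage of a unit cube under `Cᵀ`. -/
theorem hasSum_sq_norm_integral_exp_matrix_mul {C : Matrix (Fin n) (Fin n) ℝ} (hC : IsUnit C)
    (a : Fin n → ℝ) {h : EuclideanSpace ℝ (Fin n) → ℂ} (hh : MemLp h 2 volume)
    (hsupp : ∀ ξ, h ξ ≠ 0 → ∀ i, C.transpose.mulVec ξ.ofLp i ∈ Set.Ioc (a i) (a i + 1)) :
    HasSum (fun k : Fin n → ℤ => ‖∫ ξ, Complex.exp (-(2 * Real.pi * Complex.I *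
        (⟪WithLp.toLp 2 (C.mulVec fun i => (k i : ℝ)), ξ⟫ : ℝ))) * h ξ‖ ^ 2)
      (|C.det|⁻¹ * ∫ ξ, ‖h ξ‖ ^ 2) := by
  have hdet : C.det ≠ 0 := ((Matrix.isUnit_iff_isUnit_det C).1 hC).ne_zero
  have hCT : IsUnit C.transpose.det := by
    rw [Matrix.det_transpose]; exact (Matrix.isUnit_iff_isUnit_det C).1 hC
  set A : EuclideanSpace ℝ (Fin n) → (Fin n → ℝ) := fun ξ => C.transpose.mulVec ξ.ofLp with hA
  set B : (Fin n → ℝ) → EuclideanSpace ℝ (Fin n) :=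
    fun η => WithLp.toLp 2 (C.transpose⁻¹.mulVec η) with hB
  have hBA : ∀ ξ, B (A ξ) = ξ := fun ξ => by
    simp [hA, hB, Matrix.mulVec_mulVec, Matrix.nonsing_inv_mul _ hCT]
  have hAB : ∀ η, A (B η) = η := fun η => by
    simp [hA, hB, Matrix.mulVec_mulVec, Matrix.mul_nonsing_inv _ hCT]
  have hAc : Continuous A := by fun_prop
  have hBc : Continuous B := by fun_prop
  let e : EuclideanSpace ℝ (Fin n) ≃ₜ (Fin n → ℝ) := ⟨⟨A, B, hBA, hAB⟩, hAc, hBc⟩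
  have hemb : MeasurableEmbedding A := e.measurableEmbedding
  have hmap : Measure.map A volume = ENNReal.ofReal |C.det|⁻¹ • volume :=
    map_transpose_mulVec_volume hC
  have hD : 0 < |C.det|⁻¹ := by positivity
  -- substitution `η = Cᵀ ξ`
  have hint : ∀ {G : Type} [NormedAddCommGroup G] [NormedSpace ℝ G]
      (ψ : EuclideanSpace ℝ (Fin n) → G) (φ : (Fin n → ℝ) → G), (∀ ξ, ψ ξ = φ (A ξ)) →
        ∫ ξ, ψ ξ = |C.det|⁻¹ • ∫ η, φ η := by
    intro G _ _ ψ φ hψ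
    rw [funext hψ, ← hemb.integral_map, hmap, integral_smul_measure, ENNReal.toReal_ofReal hD.le]
  have hH : MemLp (h ∘ B) 2 volume := by
    have h1 : MemLp (h ∘ B) 2 (Measure.map A volume) := by
      rw [hemb.memLp_map_measure_iff]
      simpa [Function.comp_def, hBA] using hh
    rw [hmap] at h1
    have h2 := h1.smul_measure (c := ENNReal.ofReal |C.det|) ENNReal.ofReal_ne_top
    rwa [smul_smul, ← ENNReal.ofReal_mul (abs_nonneg _), mul_inv_cancel₀ (abs_ne_zero.2 hdet),
      ENNReal.ofReal_one, one_smul] at h2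
  have key := hasSum_sq_norm_integral_exp_mul a hH (fun η hη => by
    have := hsupp _ hη
    rwa [show C.transpose.mulVec (B η).ofLp = η from hAB η] at this)
  have key2 := key.mul_left (|C.det|⁻¹ ^ 2)
  have hnorm : |C.det|⁻¹ * ∫ ξ, ‖h ξ‖ ^ 2 = |C.det|⁻¹ ^ 2 * ∫ η, ‖(h ∘ B) η‖ ^ 2 := by
    have : ∀ ξ, ‖h ξ‖ ^ 2 = (fun η => ‖(h ∘ B) η‖ ^ 2) (A ξ) := fun ξ => by
      simp [Function.comp, hBA]
    rw [hint _ (fun η => ‖(h ∘ B) η‖ ^ 2) this, smul_eq_mul, sq, mul_assoc]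
  rw [hnorm]
  refine key2.congr_fun fun k => ?_
  have : ∀ ξ, Complex.exp (-(2 * Real.pi * Complex.I *
      (⟪WithLp.toLp 2 (C.mulVec fun i => (k i : ℝ)), ξ⟫ : ℝ))) * h ξ =
      (fun η : Fin n → ℝ => Complex.exp (-(2 * Real.pi * Complex.I * ∑ i, (k i : ℂ) * η i)) *
        (h ∘ B) η) (A ξ) := by
    intro ξ
    have hin : ⟪WithLp.toLp 2 (C.mulVec fun i => (k i : ℝ)), ξ⟫ = ∑ i, (k i : ℝ) * A ξ i := by
      rw [EuclideanSpace.inner_eq_star_dotProduct]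
      change ξ.ofLp ⬝ᵥ (C.mulVec fun i => (k i : ℝ)) = (fun i => (k i : ℝ)) ⬝ᵥ A ξ
      rw [Matrix.dotProduct_mulVec, ← Matrix.mulVec_transpose, dotProduct_comm]
    simp only [Function.comp, hBA, hin]
    push_cast
    rfl
  rw [hint _ (fun η => Complex.exp (-(2 * Real.pi * Complex.I * ∑ i, (k i : ℂ) * η i)) *
    (h ∘ B) η) this, norm_smul, mul_pow, Real.norm_of_nonneg hD.le]

end Lattice

/-! ### The Fourier transform of a translate -/

section Translation

variable {n : ℕ}

/-- Translation by `γ` becomes modulation. For Schwartz functions this is a computation with the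
Fourier integral, and both sides are continuous in `f`. -/
theorem fourier_translation (γ : EuclideanSpace ℝ (Fin n)) (f : L2 n) :
    (𝓕 (translation γ f) : L2 n) =ᵐ[volume] fun ξ =>
      Complex.exp (-(2 * Real.pi * Complex.I * (⟪γ, ξ⟫ : ℝ))) * (𝓕 f : L2 n) ξ := by
  set u : EuclideanSpace ℝ (Fin n) → ℂ :=
    fun ξ => Complex.exp (-(2 * Real.pi * Complex.I * (⟪γ, ξ⟫ : ℝ))) with hu
  have hunorm : ∀ ξ, ‖u ξ‖ = 1 := fun ξ => by
    simp only [hu]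
    rw [show -(2 * Real.pi * Complex.I * (⟪γ, ξ⟫ : ℝ)) =
      ((-(2 * Real.pi * ⟪γ, ξ⟫) : ℝ) : ℂ) * Complex.I by push_cast; ring]
    exact Complex.norm_exp_ofReal_mul_I _
  have humem : MemLp u ∞ volume :=
    memLp_top_of_bound (by fun_prop : Continuous u).aestronglyMeasurable 1
      (Filter.Eventually.of_forall fun ξ => (hunorm ξ).le)
  -- multiplication by the character `u` as a continuous operator on `L²`
  let M : L2 n →L[ℂ] L2 n :=
    (ContinuousLinearMap.mul ℂ ℂ).holderL volume ∞ 2 2 (humem.toLp u)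
  have hM : ∀ g : L2 n, M g =ᵐ[volume] fun ξ => u ξ * g ξ := by
    intro g
    filter_upwards [(ContinuousLinearMap.mul ℂ ℂ).coeFn_holder (r := 2) (humem.toLp u) g,
      humem.coeFn_toLp] with ξ h1 h2
    change ((ContinuousLinearMap.mul ℂ ℂ).holder 2 (humem.toLp u) g) ξ = _
    rw [h1, h2]
    rfl
  suffices h : 𝓕 (translation γ f) = M (𝓕 f) by
    rw [h]
    exact hM _
  have hdense : DenseRange (SchwartzMap.toLpCLM ℂ (E := EuclideanSpace ℝ (Fin n)) ℂ 2 volume) :=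
    SchwartzMap.denseRange_toLpCLM ENNReal.ofNat_ne_top
  induction f using hdense.induction_on with
  | hp =>
    refine isClosed_eq ?_ ?_
    · exact (Lp.fourierTransformₗᵢ (EuclideanSpace ℝ (Fin n)) ℂ).continuous.comp
        (Lp.isometry_compMeasurePreserving (measurePreserving_sub_right volume γ)).continuous
    · exact M.continuous.comp (Lp.fourierTransformₗᵢ (EuclideanSpace ℝ (Fin n)) ℂ).continuous
  | ih φ =>
    have htr : translation γ (SchwartzMap.toLpCLM ℂ ℂ 2 volume φ) =
        (φ.compSubConstCLM ℂ γ).toLp 2 := by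
      refine Lp.ext ?_
      refine (Lp.coeFn_compMeasurePreserving _ (measurePreserving_sub_right volume γ)).trans ?_
      have h1 := (measurePreserving_sub_right volume γ).quasiMeasurePreserving.ae_eq_comp
        (φ.coeFn_toLp 2 volume)
      refine h1.trans ?_
      filter_upwards [(φ.compSubConstCLM ℂ γ).coeFn_toLp 2 volume] with x hx
      rw [hx]
      rfl
    rw [htr]
    change 𝓕 ((φ.compSubConstCLM ℂ γ).toLp 2) = M (𝓕 (φ.toLp 2))
    rw [SchwartzMap.toLp_fourier_eq, SchwartzMap.toLp_fourier_eq]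
    refine Lp.ext ?_
    filter_upwards [hM ((𝓕 φ).toLp 2), (𝓕 φ).coeFn_toLp 2 volume,
      (𝓕 (φ.compSubConstCLM ℂ γ)).coeFn_toLp 2 volume] with ξ h1 h2 h3
    rw [h1, h2, h3, SchwartzMap.fourier_coe, SchwartzMap.fourier_coe]
    have := congrFun (VectorFourier.fourierIntegral_comp_add_right Real.fourierChar
      (volume : Measure (EuclideanSpace ℝ (Fin n))) (innerₗ _) φ (-γ)) ξ
    refine this.trans ?_
    rw [Circle.smul_def, Real.fourierChar_apply, smul_eq_mul]
    congr 2
    simp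
    ring

end Translation

/-! ### Singular values and covolume -/

section SingularValues

theorem LinearMap.norm_apply_le_singularValues_zero {E F : Type*} [NormedAddCommGroup E]
    [InnerProductSpace ℝ E] [FiniteDimensional ℝ E] [NormedAddCommGroup F] [InnerProductSpace ℝ F]
    [FiniteDimensional ℝ F] (T : E →ₗ[ℝ] F) (v : E) : ‖T v‖ ≤ T.singularValues 0 * ‖v‖ := by
  refine le_of_sq_le_sq ?_ (mul_nonneg (T.singularValues_nonneg 0) (norm_nonneg v))
  set b := T.isSymmetric_adjoint_comp_self.eigenvectorBasis rfl
  calc ‖T v‖ ^ 2 = ⟪v, (LinearMap.adjoint T ∘ₗ T) v⟫ := by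
        rw [LinearMap.comp_apply, LinearMap.adjoint_inner_right, real_inner_self_eq_norm_sq]
    _ = ∑ i : Fin (Module.finrank ℝ E), T.singularValues i ^ 2 * ⟪b i, v⟫ ^ 2 := by
        rw [← b.sum_inner_mul_inner]
        refine Finset.sum_congr rfl fun i _ => ?_
        rw [← T.isSymmetric_adjoint_comp_self,
          T.isSymmetric_adjoint_comp_self.apply_eigenvectorBasis rfl i, inner_smul_left,
          T.sq_singularValues_fin rfl, real_inner_comm]
        simp
        ring
    _ ≤ ∑ i, T.singularValues 0 ^ 2 * ⟪b i, v⟫ ^ 2 := by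
        gcongr with i
        · exact T.singularValues_nonneg i
        · exact T.singularValues_antitone (Nat.zero_le _)
    _ = (T.singularValues 0 * ‖v‖) ^ 2 := by
        rw [← Finset.mul_sum, mul_pow]
        congr 1
        rw [← real_inner_self_eq_norm_sq, ← b.sum_inner_mul_inner]
        refine Finset.sum_congr rfl fun i _ => ?_
        rw [real_inner_comm, sq]

variable {n : ℕ}

theorem det_toEuclideanLin (C : Matrix (Fin n) (Fin n) ℝ) :
    LinearMap.det (Matrix.toEuclideanLin C) = C.det := by
  rw [Matrix.toEuclideanLin, Matrix.toLpLin_eq_toLin, LinearMap.det_toLin]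

theorem minSingularValue_pow_le_abs_det (C : Matrix (Fin n) (Fin n) ℝ) :
    minSingularValue C ^ n ≤ |C.det| := by
  have h : |C.det| = ∏ i ∈ Finset.range n, (Matrix.toEuclideanLin C).singularValues i := by
    have h1 := (Matrix.toEuclideanLin C).normDet_eq_prod_singularValues
    rw [LinearMap.normDet_eq_abs_det, finrank_euclideanSpace_fin] at h1
    rw [← h1, det_toEuclideanLin]
  rw [h]
  calc minSingularValue C ^ n = ∏ _i ∈ Finset.range n, minSingularValue C := by simp
    _ ≤ _ := by
        refine Finset.prod_le_prod (fun _ _ => LinearMap.singularValues_nonneg _ _) fun i hi => ?_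
        exact LinearMap.singularValues_antitone _ (Nat.le_sub_one_of_lt (Finset.mem_range.1 hi))

theorem minSingularValue_pos {C : Matrix (Fin n) (Fin n) ℝ} (hC : IsUnit C) (hn : n ≠ 0) :
    0 < minSingularValue C := by
  refine (LinearMap.injective_iff_forall_lt_finrank_singularValues_pos _).1 ?_ _ ?_
  · intro v w hvw
    have : C.mulVec v.ofLp = C.mulVec w.ofLp := congrArg WithLp.ofLp hvw
    exact WithLp.ofLp_injective 2 (Matrix.mulVec_injective_of_isUnit hC this)
  · rw [finrank_euclideanSpace_fin]; omega

theorem minSingularValue_le_maxSingularValue (C : Matrix (Fin n) (Fin n) ℝ) :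
    minSingularValue C ≤ maxSingularValue C :=
  LinearMap.singularValues_antitone _ (Nat.zero_le _)

/-- The `i`-th coordinate of `Cᵀ ξ` is the inner product of `ξ` with the `i`-th column of `C`. -/
theorem abs_transpose_mulVec_le (C : Matrix (Fin n) (Fin n) ℝ) (ξ : EuclideanSpace ℝ (Fin n))
    (i : Fin n) : |C.transpose.mulVec ξ.ofLp i| ≤ maxSingularValue C * ‖ξ‖ := by
  have h : C.transpose.mulVec ξ.ofLp i =
      ⟪Matrix.toEuclideanLin C (EuclideanSpace.single i 1), ξ⟫ := by
    rw [EuclideanSpace.inner_eq_star_dotProduct]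
    simp only [Matrix.toLpLin_apply, PiLp.ofLp_single, Matrix.mulVec_single_one,
      star_trivial]
    exact dotProduct_comm _ _
  rw [h]
  refine (abs_real_inner_le_norm _ _).trans ?_
  gcongr
  refine (LinearMap.norm_apply_le_singularValues_zero _ _).trans_eq ?_
  simp [maxSingularValue]

theorem covolume_matrixLattice {C : Matrix (Fin n) (Fin n) ℝ} (hC : IsUnit C) :
    ZLattice.covolume (matrixLattice C) volume = |C.det| := by
  have hinj : Function.Injective C.mulVec := Matrix.mulVec_injective_of_isUnit hC
  let A : EuclideanSpace ℝ (Fin n) ≃ₗ[ℝ] EuclideanSpace ℝ (Fin n) :=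
    LinearEquiv.ofInjectiveEndo (Matrix.toEuclideanLin C) fun v w hvw =>
      WithLp.ofLp_injective 2 (hinj (congrArg WithLp.ofLp hvw))
  let e := EuclideanSpace.basisFun (Fin n) ℝ
  let b : Module.Basis (Fin n) ℝ (EuclideanSpace ℝ (Fin n)) := e.toBasis.map A
  have hb : ∀ i, b i = Matrix.toEuclideanLin C (EuclideanSpace.single i 1) := fun i => by
    rw [Module.Basis.map_apply, OrthonormalBasis.coe_toBasis, EuclideanSpace.basisFun_apply]
    rfl
  have hL : matrixLattice C = Submodule.span ℤ (Set.range b) := by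
    ext x
    rw [Submodule.mem_span_range_iff_exists_fun]
    refine exists_congr fun k => ?_
    have : ∑ i, k i • b i = WithLp.toLp 2 (C.mulVec fun i => (k i : ℝ)) := by
      ext j
      simp [hb, Matrix.mulVec, dotProduct, Matrix.toLpLin_apply, mul_comm]
    rw [this]
    exact eq_comm
  rw [hL, ZLattice.covolume_eq_det_mul_measureReal _ volume (b.restrictScalars ℤ) e.toBasis]
  have h1 : volume.real (ZSpan.fundamentalDomain e.toBasis) = 1 := by
    rw [measureReal_congr (ZSpan.fundamentalDomain_ae_parallelepiped e.toBasis volume),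
      measureReal_def, OrthonormalBasis.coe_toBasis, e.volume_parallelepiped]
    rfl
  have h2 : ((↑) : Submodule.span ℤ (Set.range b) → EuclideanSpace ℝ (Fin n)) ∘
      (b.restrictScalars ℤ) = (Matrix.toEuclideanLin C) ∘ e.toBasis := by
    funext i
    simp [hb, e]
  rw [h1, mul_one, h2, Module.Basis.det_comp, Module.Basis.det_self, mul_one,
    det_toEuclideanLin]

/-- A radius `r` such that `Cᵀ` maps balls of radius `r` into unit cubes, while their volume is at
least a constant multiple of `min 1 (1 / |det C|)`, the constant depending only on `n` and `K`. -/
theorem exists_radius {C : Matrix (Fin n) (Fin n) ℝ} (hC : IsUnit C) {K : ℝ} (hK0 : 0 < K)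
    (hK : maxSingularValue C / minSingularValue C ≤ K) :
    ∃ r : ℝ, 0 < r ∧ r ≤ 1 ∧ maxSingularValue C * r ≤ 1 / 4 ∧
      min 1 (((4 * K) ^ n)⁻¹ * |C.det|⁻¹) ≤ r ^ n := by
  rcases eq_or_ne n 0 with rfl | hn
  -- in dimension `0` the singular values are junk `0`, and `r = 1` works
  · have : maxSingularValue C = 0 :=
      LinearMap.singularValues_of_finrank_le _ (by rw [finrank_euclideanSpace_fin])
    exact ⟨1, one_pos, le_rfl, by rw [this]; norm_num, by simp⟩
  have hm := minSingularValue_pos hC hn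
  set σ := maxSingularValue C
  set m := minSingularValue C
  have hσ : 0 < σ := hm.trans_le (minSingularValue_le_maxSingularValue C)
  have hσK : σ ≤ K * m := (div_le_iff₀ hm).1 hK
  refine ⟨min 1 (1 / (4 * σ)), by positivity, min_le_left _ _, ?_, ?_⟩
  · calc σ * min 1 (1 / (4 * σ)) ≤ σ * (1 / (4 * σ)) := by gcongr; exact min_le_right _ _
      _ = 1 / 4 := by field_simp
  · rcases le_total 1 (1 / (4 * σ)) with h | h
    · rw [min_eq_left h, one_pow]
      exact min_le_left _ _
    · rw [min_eq_right h]
      refine (min_le_right _ _).trans ?_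
      rw [← mul_inv, div_pow, one_pow, one_div]
      gcongr
      calc (4 * σ) ^ n ≤ (4 * (K * m)) ^ n := by gcongr
        _ = (4 * K) ^ n * m ^ n := by ring
        _ ≤ _ := by gcongr; exact minSingularValue_pow_le_abs_det C

end SingularValues

/-! ### Band-limited generators -/

section Generators

variable {n : ℕ}

/-- The function in `L²(ℝⁿ)` whose Fourier transform is the indicator function of the set `s`,
scaled by `|det C|^{1/2}`. -/
noncomputable def bandGenerator (C : Matrix (Fin n) (Fin n) ℝ) {s : Set (EuclideanSpace ℝ (Fin n))}
    (hs : MeasurableSet s) (hfin : volume s ≠ ⊤) : L2 n :=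
  𝓕⁻ (indicatorConstLp 2 hs hfin (√|C.det| : ℂ))

theorem inner_translation_bandGenerator (C : Matrix (Fin n) (Fin n) ℝ)
    {s : Set (EuclideanSpace ℝ (Fin n))} (hs : MeasurableSet s) (hfin : volume s ≠ ⊤)
    (γ : EuclideanSpace ℝ (Fin n)) (f : L2 n) :
    inner ℂ f (translation γ (bandGenerator C hs hfin)) =
      ∫ ξ, Complex.exp (-(2 * Real.pi * Complex.I * (⟪γ, ξ⟫ : ℝ))) *
        s.indicator (fun ξ => (√|C.det| : ℂ) * conj ((𝓕 f : L2 n) ξ)) ξ := by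
  rw [← Lp.inner_fourier_eq, L2.inner_def]
  refine integral_congr_ae ?_
  have h1 : (𝓕 (bandGenerator C hs hfin) : L2 n) =
      indicatorConstLp 2 hs hfin (√|C.det| : ℂ) := FourierTransform.fourier_fourierInv_eq _
  filter_upwards [fourier_translation γ (bandGenerator C hs hfin),
    indicatorConstLp_coeFn (p := 2) (hs := hs) (hμs := hfin) (c := (√|C.det| : ℂ))] with ξ h2 h3
  rw [h2, h1, h3, RCLike.inner_apply, mul_assoc]
  congr 1
  by_cases hξ : ξ ∈ s <;> simp [hξ]

/-- If `Cᵀ s` lies in a unit cube, then the translates of the generator along `C ℤⁿ` resolve exactly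
the part of `f` with frequencies in `s`. -/
theorem hasSum_sq_norm_inner_translation_bandGenerator {C : Matrix (Fin n) (Fin n) ℝ}
    (hC : IsUnit C) {s : Set (EuclideanSpace ℝ (Fin n))} (hs : MeasurableSet s)
    (hfin : volume s ≠ ⊤) (a : Fin n → ℝ)
    (hsa : ∀ ξ ∈ s, ∀ i, C.transpose.mulVec ξ.ofLp i ∈ Set.Ioc (a i) (a i + 1)) (f : L2 n) :
    HasSum (fun γ : matrixLattice C =>
      ‖inner ℂ f (translation (γ : EuclideanSpace ℝ (Fin n)) (bandGenerator C hs hfin))‖ ^ 2)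
      (∫ ξ in s, ‖(𝓕 f : L2 n) ξ‖ ^ 2) := by
  have hdet : C.det ≠ 0 := ((Matrix.isUnit_iff_isUnit_det C).1 hC).ne_zero
  let e : (Fin n → ℤ) ≃ matrixLattice C := Equiv.ofBijective
    (fun k => ⟨WithLp.toLp 2 (C.mulVec fun i => (k i : ℝ)), k, rfl⟩) (by
      refine ⟨fun k l hkl => ?_, ?_⟩
      · have h1 := Matrix.mulVec_injective_of_isUnit hC
          (WithLp.toLp_injective 2 (congrArg Subtype.val hkl))
        funext i
        exact_mod_cast congrFun h1 i
      · rintro ⟨x, k, rfl⟩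
        exact ⟨k, rfl⟩)
  rw [← e.hasSum_iff]
  have hmem : MemLp (s.indicator fun ξ => (√|C.det| : ℂ) * conj ((𝓕 f : L2 n) ξ)) 2 volume :=
    (MemLp.const_mul (Lp.memLp (𝓕 f : L2 n)).star _).indicator hs
  have key := hasSum_sq_norm_integral_exp_matrix_mul hC a hmem
    (fun ξ hξ => hsa ξ (Set.mem_of_indicator_ne_zero hξ))
  have hval : |C.det|⁻¹ * ∫ ξ, ‖s.indicator
      (fun ξ => (√|C.det| : ℂ) * conj ((𝓕 f : L2 n) ξ)) ξ‖ ^ 2 =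
        ∫ ξ in s, ‖(𝓕 f : L2 n) ξ‖ ^ 2 := by
    have : ∀ ξ, ‖s.indicator (fun ξ => (√|C.det| : ℂ) * conj ((𝓕 f : L2 n) ξ)) ξ‖ ^ 2 =
        |C.det| * s.indicator (fun ξ => ‖(𝓕 f : L2 n) ξ‖ ^ 2) ξ := by
      intro ξ
      by_cases hξ : ξ ∈ s
      · simp [hξ, mul_pow, Real.sq_sqrt]
      · simp [hξ]
    simp_rw [this]
    rw [integral_const_mul, integral_indicator hs, ← mul_assoc,
      inv_mul_cancel₀ (abs_ne_zero.2 hdet), one_mul]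
  rw [hval] at key
  refine key.congr_fun fun k => ?_
  simp only [Function.comp_apply]
  rw [inner_translation_bandGenerator]
  rfl

theorem integral_sq_norm_fourier (f : L2 n) : ∫ ξ, ‖(𝓕 f : L2 n) ξ‖ ^ 2 = ‖f‖ ^ 2 := by
  rw [← Lp.norm_fourier_eq f]
  have h : inner ℂ (𝓕 f : L2 n) (𝓕 f : L2 n) = ((‖(𝓕 f : L2 n)‖ ^ 2 : ℝ) : ℂ) := by
    rw [inner_self_eq_norm_sq_to_K]; simp
  rw [L2.inner_def] at h
  have h2 : ∀ ξ, inner ℂ ((𝓕 f : L2 n) ξ) ((𝓕 f : L2 n) ξ) =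
      ((‖(𝓕 f : L2 n) ξ‖ ^ 2 : ℝ) : ℂ) := fun ξ => by
    rw [inner_self_eq_norm_sq_to_K]; simp
  simp_rw [h2] at h
  rw [integral_complex_ofReal] at h
  exact_mod_cast h

/-- Bands `s j` with `(C j)ᵀ (s j)` in a unit cube that tile the frequency space give a tight
frame. Only countably many bands are nonempty, which is what `e` encodes: `J` may be uncountable. -/
theorem isTightFrameGenerators_bandGenerator {J : Type*} {C : J → Matrix (Fin n) (Fin n) ℝ}
    (hC : ∀ j, IsUnit (C j)) {s : J → Set (EuclideanSpace ℝ (Fin n))}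
    (hs : ∀ j, MeasurableSet (s j)) (hfin : ∀ j, volume (s j) ≠ ⊤) (a : J → Fin n → ℝ)
    (hsa : ∀ j, ∀ ξ ∈ s j, ∀ i,
      (C j).transpose.mulVec ξ.ofLp i ∈ Set.Ioc (a j i) (a j i + 1))
    {e : ℕ → J} (he : Function.Injective e) (hempty : ∀ j ∉ Set.range e, s j = ∅)
    (hdisj : Pairwise (Function.onFun Disjoint fun k => s (e k)))
    (hcover : volume (⋃ k, s (e k))ᶜ = 0) :
    IsTightFrameGenerators (fun j => matrixLattice (C j))
      (fun j => bandGenerator (C j) (hs j) (hfin j)) := by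
  refine ⟨one_pos, fun f => ?_⟩
  have hin : ∀ j, HasSum (fun γ : matrixLattice (C j) => ‖inner ℂ f (gsiSystem
      (fun j => matrixLattice (C j)) (fun j => bandGenerator (C j) (hs j) (hfin j)) ⟨j, γ⟩)‖ ^ 2)
      (∫ ξ in s j, ‖(𝓕 f : L2 n) ξ‖ ^ 2) := fun j =>
    hasSum_sq_norm_inner_translation_bandGenerator (hC j) (hs j) (hfin j) (a j) (hsa j) f
  have hint : Integrable (fun ξ => ‖(𝓕 f : L2 n) ξ‖ ^ 2) volume :=
    (memLp_two_iff_integrable_sq_norm (Lp.aestronglyMeasurable _)).1 (Lp.memLp _)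
  have hout : HasSum (fun j => ∫ ξ in s j, ‖(𝓕 f : L2 n) ξ‖ ^ 2) (‖f‖ ^ 2) := by
    rw [← he.hasSum_iff fun j hj => by simp [hempty j hj]]
    have h1 := hasSum_integral_iUnion (fun k => hs (e k)) hdisj hint.integrableOn
    rwa [setIntegral_congr_set (ae_eq_univ.2 hcover), setIntegral_univ,
      integral_sq_norm_fourier] at h1
  have hsum : Summable fun p : Σ j, matrixLattice (C j) => ‖inner ℂ f (gsiSystem
      (fun j => matrixLattice (C j)) (fun j => bandGenerator (C j) (hs j) (hfin j)) p)‖ ^ 2 := by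
    rw [summable_sigma_of_nonneg fun _ => by positivity]
    refine ⟨fun j => (hin j).summable, ?_⟩
    simp_rw [fun j => (hin j).tsum_eq]
    exact hout.summable
  have htsum : ∑' p : Σ j, matrixLattice (C j), ‖inner ℂ f (gsiSystem
      (fun j => matrixLattice (C j)) (fun j => bandGenerator (C j) (hs j) (hfin j)) p)‖ ^ 2 =
        ‖f‖ ^ 2 := by
    rw [hsum.tsum_sigma]
    simp_rw [fun j => (hin j).tsum_eq]
    exact hout.tsum_eq
  refine ⟨hsum, ?_, ?_⟩ <;> rw [htsum, one_mul]

end Generators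

/-! ### Existence of tight frame generators -/

theorem proposition3p20 {n : ℕ} {J : Type*} (C : J → Matrix (Fin n) (Fin n) ℝ)
    (hC : ∀ j, IsUnit (C j))
    (hsv : ∃ K : ℝ, ∀ j, maxSingularValue (C j) / minSingularValue (C j) ≤ K)
    (hBW : bandwidth (fun j => matrixLattice (C j)) = ⊤) :
    ∃ g : J → L2 n, IsTightFrameGenerators (fun j => matrixLattice (C j)) g := by
  obtain ⟨K, hK⟩ := hsv
  have hK0 : 0 < max K 1 := by positivity
  -- enlarging `K` makes it positive also when `n = 0`, where all quotients are `0`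
  choose r hr0 hr1 hσ hrn using fun j =>
    exists_radius (hC j) hK0 ((hK j).trans (le_max_left K 1))
  set c : ℝ := ((4 * max K 1) ^ n)⁻¹ with hc
  have hc0 : 0 < c := by positivity
  have hball : ∑' j, volume (Metric.ball (0 : EuclideanSpace ℝ (Fin n)) (r j)) = ⊤ := by
    have h1 : ∑' j, min 1 (ENNReal.ofReal c * ENNReal.ofReal
        (1 / ZLattice.covolume (matrixLattice (C j)) volume)) = ⊤ := by
      refine ENNReal.tsum_min_one_eq_top
        (fun j => ENNReal.mul_ne_top ENNReal.ofReal_ne_top ENNReal.ofReal_ne_top) ?_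
      rw [ENNReal.tsum_mul_left]
      change ENNReal.ofReal c * bandwidth (fun j => matrixLattice (C j)) = ⊤
      rw [hBW, ENNReal.mul_top (by simpa using hc0)]
    have hω : volume (Metric.ball (0 : EuclideanSpace ℝ (Fin n)) 1) ≠ 0 :=
      (Metric.measure_ball_pos volume 0 one_pos).ne'
    rw [← top_le_iff, ← ENNReal.top_mul hω, ← h1, ← ENNReal.tsum_mul_right]
    refine ENNReal.tsum_le_tsum fun j => ?_
    rw [Measure.addHaar_ball_of_pos volume 0 (hr0 j), finrank_euclideanSpace_fin]
    gcongr
    rw [covolume_matrixLattice (hC j), ← ENNReal.ofReal_mul hc0.le, ← ENNReal.ofReal_one,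
      ← ENNReal.ofReal_min, one_div]
    exact ENNReal.ofReal_le_ofReal (hrn j)
  obtain ⟨e, he, hesum⟩ :=
    ENNReal.exists_injective_tsum_eq_top (fun j => measure_ball_lt_top.ne) hball
  obtain ⟨t, x, htm, htd, htx, htc⟩ :=
    exists_disjoint_subset_ball_ae_cover volume (r ∘ e) (fun k => hr1 _) hesum
  -- indices outside the chosen sequence get an empty band, that is, a zero generator
  set s : J → Set (EuclideanSpace ℝ (Fin n)) := Function.extend e t fun _ => ∅ with hs
  set y : J → EuclideanSpace ℝ (Fin n) := Function.extend e x fun _ => 0 with hy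
  have hse : ∀ k, s (e k) = t k := fun k => he.extend_apply _ _ k
  have hye : ∀ k, y (e k) = x k := fun k => he.extend_apply _ _ k
  have hs0 : ∀ j ∉ Set.range e, s j = ∅ := fun j hj =>
    Function.extend_apply' _ _ _ (by simpa using hj)
  have hsm : ∀ j, MeasurableSet (s j) := fun j => by
    by_cases hj : j ∈ Set.range e
    · obtain ⟨k, rfl⟩ := hj
      rw [hse]
      exact htm k
    · rw [hs0 j hj]
      exact MeasurableSet.empty
  have hsb : ∀ j, s j ⊆ Metric.ball (y j) (r j) := fun j => by
    by_cases hj : j ∈ Set.range e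
    · obtain ⟨k, rfl⟩ := hj
      rw [hse, hye]
      exact htx k
    · rw [hs0 j hj]
      exact Set.empty_subset _
  refine ⟨_, isTightFrameGenerators_bandGenerator hC hsm
    (fun j => measure_ne_top_of_subset (hsb j) measure_ball_lt_top.ne)
    (fun j i => (C j).transpose.mulVec (y j).ofLp i - 1 / 2) ?_ he hs0 ?_ ?_⟩
  · intro j ξ hξ i
    have h1 := hsb j hξ
    rw [Metric.mem_ball, dist_eq_norm] at h1
    have h2 := abs_transpose_mulVec_le (C j) (ξ - y j) i
    have h3 : maxSingularValue (C j) * ‖ξ - y j‖ ≤ maxSingularValue (C j) * r j :=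
      mul_le_mul_of_nonneg_left h1.le (LinearMap.singularValues_nonneg _ _)
    rw [WithLp.ofLp_sub, Matrix.mulVec_sub, Pi.sub_apply] at h2
    have h4 := abs_le.1 (h2.trans (h3.trans (hσ j)))
    constructor <;> linarith [h4.1, h4.2]
  · simpa only [hse] using htd
  · simpa only [hse] using htc
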